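/- There is a universal constant $C>0$ such that for all integers $m\ge 1$ and $1\le k\le n$ and every error parameter $0<\delta<\tfrac12$ there is a quantum query algorithm which, given the standard oracle $O_A:|i\rangle|b\rangle\mapsto|i\rangle|b\oplus A_i\rangle$ to an arbitrary array $A=(A_i)_{i=0}^{n-1}$ with entries in $\{0,\dots,m-1\}$, decides with probability at least $1-\delta$ whether $A$ has $k$ distinct indices with identical values ($k$-Distinctness), and which makes at most $$C\cdot\frac{n^{3/2}}{\sqrt{k}}\,\log\frac{n}{\delta k}$$ queries to $O_A$ and uses at most $$C\cdot(\log m+\log n)\,\log\frac{n}{\delta k}$$ qubits in total. Here $O_A$ acts on an index register of $\lceil\log_2 n\rceil$ qubits and a value register of $\lceil\log_2 m\rceil$ qubits, both counted among the qubits, and as the identity on labels $i\ge n$. A quantum query algorithm with $T$ queries applies $U_T O_A U_{T-1}\cdots O_A U_0$ to the all-zero state, with unitaries $U_t$ that act on all its qubits and may depend on $n,m,k,\delta$ but not on $A$, measures in the standard basis and answers according to the outcome. -/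

import Mathlib

open scoped Matrix

noncomputable section

/-- The array `A` has `k` distinct indices with identical values. -/
def KDistinct {n m : ℕ} (A : Fin n → Fin m) (k : ℕ) : Prop :=
  ∃ s : Finset (Fin n), s.card = k ∧ ∀ i ∈ s, ∀ j ∈ s, A i = A j

/-- Standard basis labels `|i⟩|b⟩|z⟩` of a machine that queries an `n`-sized `m`-valued array:
`⌈log₂ n⌉` index qubits, `⌈log₂ m⌉` value qubits and `w` work qubits. -/
abbrev QBasis (n m w : ℕ) : Type :=
  BitVec (Nat.clog 2 n) × BitVec (Nat.clog 2 m) × BitVec w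

/-- Action of the array oracle on basis labels: `|i⟩|b⟩|z⟩ ↦ |i⟩|b ⊕ A i⟩|z⟩` for `i < n`; the
labels with `i ≥ n`, which are not indices of the array, are left unchanged. -/
def queryMap {n m : ℕ} (A : Fin n → Fin m) (w : ℕ) (s : QBasis n m w) : QBasis n m w :=
  if h : s.1.toNat < n then
    (s.1, s.2.1 ^^^ BitVec.ofNat (Nat.clog 2 m) (A ⟨s.1.toNat, h⟩ : ℕ), s.2.2)
  else s

/-- The array oracle `O_A`: the linear extension of `queryMap`, as a matrix in the standard
basis. -/
def oracleMatrix {n m : ℕ} (A : Fin n → Fin m) (w : ℕ) :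
    Matrix (QBasis n m w) (QBasis n m w) ℂ :=
  Matrix.of fun r c => if r = queryMap A w c then 1 else 0

/-- A quantum query algorithm for `n`-sized `m`-valued arrays: it applies
`U_T O_A U_{T-1} O_A ⋯ U_1 O_A U_0` to the all-zero state, where the unitaries `U_t` act on all
of its qubits and do not depend on the array, measures all qubits in the standard basis, and
answers with a Boolean determined by the measured label. -/
structure QueryAlgorithm (n m : ℕ) where
  /-- number of work qubits, besides the index and the value registers of the oracle -/
  workQubits : ℕ
  /-- number `T` of oracle queries -/
  queries : ℕ
  /-- the unitaries between the queries (only `U 0, …, U T` are used) -/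
  U : ℕ → Matrix.unitaryGroup (QBasis n m workQubits) ℂ
  /-- the answer read off from the measured label -/
  answer : QBasis n m workQubits → Bool

namespace QueryAlgorithm

variable {n m : ℕ}

/-- Total number of qubits, the registers of the oracle included. -/
def qubits (𝒜 : QueryAlgorithm n m) : ℕ :=
  Nat.clog 2 n + Nat.clog 2 m + 𝒜.workQubits

/-- The vector of amplitudes after `t` queries (and the unitary that follows the last one). -/
def stateAfter (𝒜 : QueryAlgorithm n m) (A : Fin n → Fin m) :
    ℕ → QBasis n m 𝒜.workQubits → ℂ
  | 0 => (𝒜.U 0).1 *ᵥ Pi.single (0, 0, 0) 1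
  | t + 1 => (𝒜.U (t + 1)).1 *ᵥ (oracleMatrix A 𝒜.workQubits *ᵥ stateAfter 𝒜 A t)

/-- Probability that the algorithm answers `b` on the array `A`. -/
def probAnswer (𝒜 : QueryAlgorithm n m) (A : Fin n → Fin m) (b : Bool) : ℝ :=
  ∑ s : QBasis n m 𝒜.workQubits,
    if 𝒜.answer s = b then ‖𝒜.stateAfter A 𝒜.queries s‖ ^ 2 else 0

open Classical in
/-- On every array, the algorithm decides correctly, except with probability at most `δ`,
whether the array has `k` distinct indices with identical values. -/
def SolvesKDistinctness (𝒜 : QueryAlgorithm n m) (k : ℕ) (δ : ℝ) : Prop :=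
  ∀ A : Fin n → Fin m, 1 - δ ≤ 𝒜.probAnswer A (decide (KDistinct A k))

end QueryAlgorithm

end

noncomputable section

/-! The algorithm is a Grover search for an index whose entry occurs at least `k` times. If the
array has `k` equal entries, at least `k` indices are marked, so about `√(n/k)` Grover iterations
suffice. Testing an index means loading its entry and counting its occurrences by a linear scan of
`2n + 1` queries, with memory only for one index, one entry and a counter. This gives
`O(n^{3/2}/√k)` queries on `O(log n + log m)` qubits per search.

The number `t` of marked labels is unknown. The number of iterations is therefore kept in
superposition over `0, …, M - 1`, where `M = 2 ^ a` has order `√(n/k)`. Padding by one bit keeps the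
marked fraction at most `1/2`; the average failure probability is then at most `3/4`
(`sum_cos_sq_le`, `one_le_mul_sin`). If nothing is marked, the search never accepts.

The model has a single final measurement, so the `r` repetitions run side by side on `r` copies of
the work register, in a product state. They share the oracle registers and use them one after the
other. Failure drops to `(3/4) ^ r`, with `r` of order `log (n/(δk))`, at the cost of a factor `r`
in queries and in work qubits.

`exists_search_algorithm` combines these facts. States are tracked through `Reachable`, and
`Reachable.exists_algorithm` translates the result into the model. -/

/-- Index register, value register and a work register with basis labels `R`. -/
abbrev Register (n m : ℕ) (R : Type) : Type :=
  BitVec (Nat.clog 2 n) × BitVec (Nat.clog 2 m) × R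

/-! ### Reversible circuits with queries, reachable states and the query model -/

section Registers

variable {n m : ℕ} {R : Type}

/-- The label that the oracle adds to the value register at the index label `x`. -/
def queryValue (A : Fin n → Fin m) (x : BitVec (Nat.clog 2 n)) : BitVec (Nat.clog 2 m) :=
  if h : x.toNat < n then BitVec.ofNat (Nat.clog 2 m) (A ⟨x.toNat, h⟩ : ℕ) else 0

/-- The oracle as a permutation of the basis labels. -/
def queryPerm (R : Type) (A : Fin n → Fin m) : Equiv.Perm (Register n m R) :=
  Function.Involutive.toPerm (fun s => (s.1, s.2.1 ^^^ queryValue A s.1, s.2.2)) fun s => by simp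

lemma queryPerm_apply (A : Fin n → Fin m) (x : BitVec (Nat.clog 2 n))
    (b : BitVec (Nat.clog 2 m)) (z : R) :
    queryPerm R A (x, b, z) = (x, b ^^^ queryValue A x, z) := rfl

lemma queryPerm_inv (A : Fin n → Fin m) : (queryPerm R A)⁻¹ = queryPerm R A := rfl

/-- Families of permutations of the basis labels that are computed with a given number of
queries. -/
inductive QueryCircuit : ℕ → ((Fin n → Fin m) → Equiv.Perm (Register n m R)) → Prop
  | free (σ : Equiv.Perm (Register n m R)) : QueryCircuit 0 fun _ => σ
  | query : QueryCircuit 1 (queryPerm R)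
  | mul {s t : ℕ} {π σ : (Fin n → Fin m) → Equiv.Perm (Register n m R)}
      (hπ : QueryCircuit s π) (hσ : QueryCircuit t σ) :
      QueryCircuit (s + t) fun A => π A * σ A

lemma QueryCircuit.inv {t : ℕ} {π : (Fin n → Fin m) → Equiv.Perm (Register n m R)}
    (h : QueryCircuit t π) : QueryCircuit t fun A => (π A)⁻¹ := by
  induction h with
  | free σ => exact .free _
  | query => exact .query
  | mul _ _ ih₁ ih₂ =>
    rw [Nat.add_comm]
    simpa only [mul_inv_rev] using ih₂.mul ih₁

lemma QueryCircuit.list_prod {ι : Type} {t : ℕ}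
    {π : ι → (Fin n → Fin m) → Equiv.Perm (Register n m R)}
    (h : ∀ i, QueryCircuit t (π i)) (l : List ι) :
    QueryCircuit (l.length * t) fun A => (l.map fun i => π i A).prod := by
  induction l with
  | nil => simpa using QueryCircuit.free (n := n) (m := m) (1 : Equiv.Perm (Register n m R))
  | cons i l ih =>
    rw [List.length_cons, Nat.succ_mul, Nat.add_comm]
    simpa only [List.map_cons, List.prod_cons] using (h i).mul ih

lemma queryMap_eq (A : Fin n → Fin m) (w : ℕ) (s : QBasis n m w) :
    queryMap A w s = queryPerm (BitVec w) A s := by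
  obtain ⟨x, b, z⟩ := s
  rw [queryPerm_apply]
  unfold queryMap queryValue
  split_ifs <;> simp

lemma oracleMatrix_mulVec (A : Fin n → Fin m) (w : ℕ) (ψ : QBasis n m w → ℂ) :
    oracleMatrix A w *ᵥ ψ = ψ ∘ queryPerm (BitVec w) A := by
  funext r
  have h : ∀ c, (r = queryMap A w c) ↔ (c = queryPerm (BitVec w) A r) := fun c => by
    rw [queryMap_eq, eq_comm, ← Equiv.Perm.eq_inv_iff_eq, queryPerm_inv]
  simp [oracleMatrix, Matrix.mulVec, dotProduct, h]

variable [Fintype R] [DecidableEq R]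

/-- The families of states (indexed by the array) that are prepared with `T` queries from the
basis label `(0, 0, z₀)`. -/
inductive Reachable (z₀ : R) : ℕ → ((Fin n → Fin m) → Register n m R → ℂ) → Prop
  | init : Reachable z₀ 0 fun _ => Pi.single (0, 0, z₀) 1
  | unitary {T : ℕ} {ψ : (Fin n → Fin m) → Register n m R → ℂ}
      (U : Matrix (Register n m R) (Register n m R) ℂ) (hU : U ∈ Matrix.unitaryGroup _ ℂ)
      (h : Reachable z₀ T ψ) : Reachable z₀ T fun A => U *ᵥ ψ A
  | query {T : ℕ} {ψ : (Fin n → Fin m) → Register n m R → ℂ} (h : Reachable z₀ T ψ) :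
      Reachable z₀ (T + 1) fun A => ψ A ∘ queryPerm R A

/-- Only the unitaries up to index `t` have acted by then; this permits changing a later one, the
query count or the answer. -/
lemma stateAfter_congr {w q q' : ℕ} {U U' : ℕ → Matrix.unitaryGroup (QBasis n m w) ℂ}
    {a a' : QBasis n m w → Bool} (A : Fin n → Fin m) (t : ℕ) (h : ∀ i ≤ t, U i = U' i) :
    (⟨w, q, U, a⟩ : QueryAlgorithm n m).stateAfter A t =
      (⟨w, q', U', a'⟩ : QueryAlgorithm n m).stateAfter A t := by
  induction t with
  | zero => simp [QueryAlgorithm.stateAfter, h 0 le_rfl]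
  | succ t ih =>
    simp only [QueryAlgorithm.stateAfter]
    rw [ih fun i hi => h i (by omega), h (t + 1) le_rfl]

/-- A further unitary is absorbed into the last one, `U T`; a query opens a new slot that is filled
with the identity. -/
lemma Reachable.exists_unitaries {z₀ : R} {T : ℕ}
    {ψ : (Fin n → Fin m) → Register n m R → ℂ} (h : Reachable z₀ T ψ) {w : ℕ}
    (e : BitVec w ≃ R) (he : e 0 = z₀) :
    ∃ U : ℕ → Matrix.unitaryGroup (QBasis n m w) ℂ, ∀ q a A,
      (⟨w, q, U, a⟩ : QueryAlgorithm n m).stateAfter A T =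
        fun s => ψ A (s.1, s.2.1, e s.2.2) := by
  induction h with
  | init =>
    refine ⟨fun _ => 1, fun q a A => ?_⟩
    subst he
    funext s
    change ((1 : Matrix (QBasis n m w) (QBasis n m w) ℂ) *ᵥ Pi.single (0, 0, 0) 1) s = _
    rw [Matrix.one_mulVec]
    simp [Pi.single_apply, Prod.ext_iff]
  | @unitary T ψ V hV h ih =>
    obtain ⟨U, hU⟩ := ih
    let E : QBasis n m w ≃ Register n m R :=
      (Equiv.refl _).prodCongr ((Equiv.refl _).prodCongr e)
    have hE : ∀ s, E s = (s.1, s.2.1, e s.2.2) := fun s => rfl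
    have hV' : V.submatrix E E ∈ Matrix.unitaryGroup (QBasis n m w) ℂ := by
      rw [Matrix.mem_unitaryGroup_iff] at hV ⊢
      rw [Matrix.star_eq_conjTranspose, Matrix.conjTranspose_submatrix,
        Matrix.submatrix_mul_equiv, ← Matrix.star_eq_conjTranspose, hV,
        Matrix.submatrix_one_equiv]
    refine ⟨Function.update U T (⟨_, hV'⟩ * U T), fun q a A => ?_⟩
    have key : (fun s => (V *ᵥ ψ A) (s.1, s.2.1, e s.2.2)) =
        V.submatrix E E *ᵥ (⟨w, q, U, a⟩ : QueryAlgorithm n m).stateAfter A T := by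
      rw [hU q a A, Matrix.submatrix_mulVec_equiv]
      funext s
      simp only [Function.comp_apply, hE]
      congr 2
      funext r
      simp [Function.comp_apply, E]
    rw [key]
    cases T with
    | zero =>
      simp only [QueryAlgorithm.stateAfter, Function.update_self, Submonoid.coe_mul,
        Matrix.mulVec_mulVec]
    | succ t =>
      simp only [QueryAlgorithm.stateAfter, Function.update_self]
      rw [stateAfter_congr (q' := q) (U' := U) (a' := a) A t
        fun i hi => Function.update_of_ne (by omega) _ _]
      simp only [Submonoid.coe_mul, Matrix.mulVec_mulVec, Matrix.mul_assoc]
  | @query T ψ h ih =>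
    obtain ⟨U, hU⟩ := ih
    refine ⟨Function.update U (T + 1) 1, fun q a A => ?_⟩
    simp only [QueryAlgorithm.stateAfter, Function.update_self]
    rw [stateAfter_congr (q' := q) (U' := U) (a' := a) A T
        fun i hi => Function.update_of_ne (by omega) _ _, hU, oracleMatrix_mulVec]
    funext s
    simp [queryPerm, Function.Involutive.toPerm]

/-- A preparation with `T` queries followed by a measurement is a query algorithm. -/
theorem Reachable.exists_algorithm {z₀ : R} {T : ℕ}
    {ψ : (Fin n → Fin m) → Register n m R → ℂ} (h : Reachable z₀ T ψ) {w : ℕ}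
    (hw : Fintype.card R = 2 ^ w) (ans : Register n m R → Bool) :
    ∃ 𝒜 : QueryAlgorithm n m, 𝒜.workQubits = w ∧ 𝒜.queries = T ∧ ∀ A b,
      𝒜.probAnswer A b = ∑ q, if ans q = b then ‖ψ A q‖ ^ 2 else 0 := by
  let e₀ : BitVec w ≃ R := BitVec.equivFin.toEquiv.trans
    ((finCongr hw.symm).trans (Fintype.equivFin R).symm)
  let e : BitVec w ≃ R := e₀.trans (Equiv.swap (e₀ 0) z₀)
  have he : e 0 = z₀ := by simp [e]
  let E : QBasis n m w ≃ Register n m R :=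
    (Equiv.refl _).prodCongr ((Equiv.refl _).prodCongr e)
  have hE : ∀ s, E s = (s.1, s.2.1, e s.2.2) := fun s => rfl
  obtain ⟨U, hU⟩ := h.exists_unitaries e he
  refine ⟨⟨w, T, U, fun s => ans (E s)⟩, rfl, rfl, fun A b => ?_⟩
  unfold QueryAlgorithm.probAnswer
  simp only [hU]
  exact Equiv.sum_comp E fun q => if ans q = b then ‖ψ A q‖ ^ 2 else 0

lemma permMatrix_mem_unitary {Q : Type} [Fintype Q] [DecidableEq Q] (σ : Equiv.Perm Q) :
    (1 : Matrix Q Q ℂ).submatrix σ id ∈ Matrix.unitaryGroup Q ℂ := by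
  rw [Matrix.mem_unitaryGroup_iff, Matrix.star_eq_conjTranspose, Matrix.conjTranspose_submatrix,
    Matrix.conjTranspose_one, ← Equiv.coe_refl, Matrix.submatrix_mul_equiv, mul_one,
    Matrix.submatrix_one_equiv]

lemma permMatrix_mulVec {Q : Type} [Fintype Q] [DecidableEq Q] (σ : Equiv.Perm Q) (ψ : Q → ℂ) :
    (1 : Matrix Q Q ℂ).submatrix σ id *ᵥ ψ = ψ ∘ σ := by
  funext r
  simp [Matrix.mulVec, dotProduct, Matrix.one_apply]

/-- Precomposition with `π A` carries the amplitude at `π A q` to `q`, so it runs the circuit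
backwards. Running `π` forwards means precomposing with its inverse. -/
lemma Reachable.circuit {z₀ : R} {T t : ℕ} {ψ : (Fin n → Fin m) → Register n m R → ℂ}
    {π : (Fin n → Fin m) → Equiv.Perm (Register n m R)} (hπ : QueryCircuit t π)
    (h : Reachable z₀ T ψ) : Reachable z₀ (T + t) fun A => ψ A ∘ π A := by
  induction hπ generalizing T ψ with
  | free σ =>
    simpa only [permMatrix_mulVec, add_zero] using h.unitary _ (permMatrix_mem_unitary σ)
  | query => exact h.query
  | mul _ _ ih₁ ih₂ =>
    rw [← Nat.add_assoc]
    simpa only [Equiv.Perm.coe_mul, Function.comp_assoc] using ih₂ (ih₁ h)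

lemma diagonal_mem_unitary {Q : Type} [Fintype Q] [DecidableEq Q] {d : Q → ℂ}
    (hd : ∀ q, d q * star (d q) = 1) : Matrix.diagonal d ∈ Matrix.unitaryGroup Q ℂ := by
  rw [Matrix.mem_unitaryGroup_iff, Matrix.star_eq_conjTranspose, Matrix.diagonal_conjTranspose,
    Matrix.diagonal_mul_diagonal, ← Matrix.diagonal_one]
  exact congrArg _ (funext hd)

/-- Computing, applying a phase and uncomputing multiplies the amplitudes by phases. -/
lemma Reachable.phase {z₀ : R} {T t : ℕ} {ψ : (Fin n → Fin m) → Register n m R → ℂ}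
    {π : (Fin n → Fin m) → Equiv.Perm (Register n m R)} (hπ : QueryCircuit t π)
    {d : Register n m R → ℂ} (hd : ∀ q, d q * star (d q) = 1) (h : Reachable z₀ T ψ) :
    Reachable z₀ (T + 2 * t) fun A q => d (π A q) * ψ A q := by
  have := ((h.circuit hπ.inv).unitary _ (diagonal_mem_unitary hd)).circuit hπ
  rw [Nat.two_mul, ← Nat.add_assoc]
  convert this using 3 with A q
  simp [Matrix.mulVec_diagonal]

end Registers

/-! ### Parallel copies sharing the oracle registers -/

section Copies

variable {n m r : ℕ} {S : Type}

/-- The permutation of `r` copies of the work register that acts as `σ` on copy `l`. -/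
def atCopy (l : Fin r) (σ : Equiv.Perm (Register n m S)) :
    Equiv.Perm (Register n m (Fin r → S)) where
  toFun q := ((σ (q.1, q.2.1, q.2.2 l)).1, (σ (q.1, q.2.1, q.2.2 l)).2.1,
    Function.update q.2.2 l (σ (q.1, q.2.1, q.2.2 l)).2.2)
  invFun q := ((σ⁻¹ (q.1, q.2.1, q.2.2 l)).1, (σ⁻¹ (q.1, q.2.1, q.2.2 l)).2.1,
    Function.update q.2.2 l (σ⁻¹ (q.1, q.2.1, q.2.2 l)).2.2)
  left_inv q := by simp
  right_inv q := by simp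

lemma atCopy_apply (l : Fin r) (σ : Equiv.Perm (Register n m S))
    (q : Register n m (Fin r → S)) :
    atCopy l σ q = ((σ (q.1, q.2.1, q.2.2 l)).1, (σ (q.1, q.2.1, q.2.2 l)).2.1,
      Function.update q.2.2 l (σ (q.1, q.2.1, q.2.2 l)).2.2) := rfl

lemma atCopy_mul (l : Fin r) (σ τ : Equiv.Perm (Register n m S)) :
    atCopy l (σ * τ) = atCopy l σ * atCopy l τ := by
  ext1 q
  simp [atCopy_apply]

lemma atCopy_queryPerm (l : Fin r) (A : Fin n → Fin m) :
    atCopy l (queryPerm S A) = queryPerm (Fin r → S) A := by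
  ext1 ⟨x, b, f⟩
  simp [atCopy_apply, queryPerm_apply]

lemma QueryCircuit.atCopy {t : ℕ} {π : (Fin n → Fin m) → Equiv.Perm (Register n m S)}
    (h : QueryCircuit t π) (l : Fin r) : QueryCircuit t fun A => atCopy l (π A) := by
  induction h with
  | free σ => exact .free _
  | query => simpa only [atCopy_queryPerm] using QueryCircuit.query
  | mul _ _ ih₁ ih₂ => simpa only [atCopy_mul] using ih₁.mul ih₂

/-- Each copy hands the oracle registers back in the label `0`, so the next one meets the same
initial condition; without repetitions in `L`, no copy is treated twice. -/
lemma atCopy_list_prod {σ : Equiv.Perm (Register n m S)} {p : S → S}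
    (h : ∀ s, σ (0, 0, s) = (0, 0, p s)) (L : List (Fin r)) (hL : L.Nodup) (f : Fin r → S) :
    (L.map fun l => atCopy l σ).prod (0, 0, f) =
      (0, 0, fun l => if l ∈ L then p (f l) else f l) := by
  induction L with
  | nil => simp
  | cons l L ih =>
    obtain ⟨hl, hL⟩ := List.nodup_cons.1 hL
    rw [List.map_cons, List.prod_cons, Equiv.Perm.mul_apply, ih hL, atCopy_apply]
    simp only [hl, if_false, h]
    congr 2
    funext i
    by_cases hi : i = l
    · subst hi; simp
    · simp [hi]

/-- A circuit on one copy that returns the oracle registers to `0` is run on all copies. -/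
lemma QueryCircuit.exists_allCopies {t : ℕ}
    {π : (Fin n → Fin m) → Equiv.Perm (Register n m S)} (h : QueryCircuit t π)
    {p : (Fin n → Fin m) → S → S} (hp : ∀ A s, π A (0, 0, s) = (0, 0, p A s)) (r : ℕ) :
    ∃ P : (Fin n → Fin m) → Equiv.Perm (Register n m (Fin r → S)),
      QueryCircuit (r * t) P ∧ ∀ A f, P A (0, 0, f) = (0, 0, fun l => p A (f l)) := by
  refine ⟨fun A => ((List.finRange r).map fun l => _root_.atCopy l (π A)).prod, ?_,
    fun A f => ?_⟩
  · simpa using QueryCircuit.list_prod (fun l : Fin r => h.atCopy l) (List.finRange r)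
  rw [atCopy_list_prod (hp A) _ (List.nodup_finRange r)]
  simp

/-- The product state of `r` copies of `φ`, with the oracle registers in the label `0`. -/
def productState (n m r : ℕ) (φ : S → ℂ) : Register n m (Fin r → S) → ℂ :=
  fun q => if q.1 = 0 ∧ q.2.1 = 0 then ∏ l, φ (q.2.2 l) else 0

lemma productState_single [DecidableEq S] (s₀ : S) :
    productState n m r (Pi.single s₀ 1) = Pi.single (0, 0, fun _ => s₀) 1 := by
  funext ⟨x, b, f⟩
  simp only [productState, Pi.single_apply, Finset.prod_ite_zero, Finset.prod_const_one,
    Finset.mem_univ, true_imp_iff, Prod.mk.injEq, funext_iff]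
  split_ifs <;> first | rfl | tauto

/-- The `r`-fold tensor power of a matrix. -/
def tensorPower (r : ℕ) (U : Matrix S S ℂ) : Matrix (Fin r → S) (Fin r → S) ℂ :=
  Matrix.of fun f g => ∏ l, U (f l) (g l)

lemma tensorPower_one [DecidableEq S] : tensorPower r (1 : Matrix S S ℂ) = 1 := by
  ext f g
  simp only [tensorPower, Matrix.of_apply, Matrix.one_apply, Finset.prod_ite_zero,
    Finset.prod_const_one, Finset.mem_univ, true_imp_iff, funext_iff]

/-- A unitary on one copy, applied to every copy. -/
def onCopies (n m r : ℕ) (U : Matrix S S ℂ) :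
    Matrix (Register n m (Fin r → S)) (Register n m (Fin r → S)) ℂ :=
  Matrix.kronecker 1 (Matrix.kronecker 1 (tensorPower r U))

variable [Fintype S]

lemma tensorPower_mul (U V : Matrix S S ℂ) :
    tensorPower r U * tensorPower r V = tensorPower r (U * V) := by
  ext f g
  simp only [tensorPower, Matrix.mul_apply, Matrix.of_apply, ← Finset.prod_mul_distrib]
  rw [Fintype.prod_sum]

lemma onCopies_mulVec (U : Matrix S S ℂ) (φ : S → ℂ) :
    onCopies n m r U *ᵥ productState n m r φ = productState n m r (U *ᵥ φ) := by
  funext ⟨x, b, f⟩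
  simp only [onCopies, Matrix.mulVec, dotProduct, productState, Fintype.sum_prod_type,
    Matrix.kronecker, Matrix.kroneckerMap_apply, Matrix.one_apply, Fintype.prod_sum,
    tensorPower, Matrix.of_apply, Finset.prod_mul_distrib]
  rw [Finset.sum_eq_single x, Finset.sum_eq_single b]
  · simp only [if_true, one_mul]
    split_ifs <;> simp
  · intro y _ hy; simp [Ne.symm hy]
  · simp
  · intro y _ hy; simp [Ne.symm hy]
  · simp

/-- Probability of the outcome "no copy is accepted" when the copies are measured after `P`. -/
lemma sum_norm_sq_comp_inv {P : Equiv.Perm (Register n m (Fin r → S))} {p : S → S}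
    (hp : ∀ f, P (0, 0, f) = (0, 0, fun l => p (f l))) (φ : S → ℂ) (acc : S → Prop)
    [DecidablePred acc] :
    (∑ q, if ∀ l, ¬ acc (q.2.2 l) then ‖(productState n m r φ ∘ ⇑P⁻¹) q‖ ^ 2 else 0) =
      (∑ s, if ¬ acc (p s) then ‖φ s‖ ^ 2 else 0) ^ r := by
  rw [← Equiv.sum_comp P]
  have hinv : ∀ q, P⁻¹ (P q) = q := P.symm_apply_apply
  simp only [Function.comp_apply, hinv, Fintype.sum_prod_type]
  rw [Finset.sum_eq_single 0, Finset.sum_eq_single 0]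
  · simp only [hp, productState, and_self, if_true, norm_prod, ← Finset.prod_pow]
    -- Expanding the `r`-th power gives a sum over all tuples of copy labels, compared tuple by
    -- tuple.
    rw [← Fin.prod_const, Fintype.prod_sum]
    refine Finset.sum_congr rfl fun f _ => ?_
    split_ifs with h
    · exact Finset.prod_congr rfl fun l _ => by rw [if_pos (h l)]
    · push Not at h
      obtain ⟨l, hl⟩ := h
      exact (Finset.prod_eq_zero (Finset.mem_univ l) (by simp [hl])).symm
  · intro b _ hb
    simp only [productState, hb, and_false, if_false]
    simp
  · simp
  · intro b _ hb
    simp only [productState, hb, false_and, if_false]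
    simp
  · simp

lemma sum_norm_sq_comp_perm (P : Equiv.Perm (Register n m (Fin r → S))) (φ : S → ℂ) :
    (∑ q, ‖(productState n m r φ ∘ ⇑P) q‖ ^ 2) = (∑ s, ‖φ s‖ ^ 2) ^ r := by
  have := sum_norm_sq_comp_inv (n := n) (m := m) (r := r) (P := 1) (p := id)
    (fun _ => rfl) φ fun _ => False
  simp only [not_false_eq_true, if_true, implies_true, inv_one, Equiv.Perm.coe_one,
    Function.comp_id] at this
  rw [← this]
  exact Equiv.sum_comp P fun q => ‖productState n m r φ q‖ ^ 2

variable [DecidableEq S]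

lemma tensorPower_mem_unitary {U : Matrix S S ℂ} (hU : U ∈ Matrix.unitaryGroup S ℂ) :
    tensorPower r U ∈ Matrix.unitaryGroup (Fin r → S) ℂ := by
  rw [Matrix.mem_unitaryGroup_iff] at hU ⊢
  have : star (tensorPower r U) = tensorPower r (star U) := by
    ext f g
    simp [tensorPower, Matrix.star_apply]
  rw [this, tensorPower_mul, hU, tensorPower_one]

lemma onCopies_mem_unitary {U : Matrix S S ℂ} (hU : U ∈ Matrix.unitaryGroup S ℂ) :
    onCopies n m r U ∈ Matrix.unitaryGroup (Register n m (Fin r → S)) ℂ :=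
  Matrix.kronecker_mem_unitary (one_mem _)
    (Matrix.kronecker_mem_unitary (one_mem _) (tensorPower_mem_unitary hU))

lemma Reachable.productState_init {U : Matrix S S ℂ} (hU : U ∈ Matrix.unitaryGroup S ℂ)
    (s₀ : S) : Reachable (n := n) (m := m) (fun _ : Fin r => s₀) 0
      fun _ => productState n m r (U *ᵥ Pi.single s₀ 1) := by
  simp only [← onCopies_mulVec, productState_single]
  exact Reachable.init.unitary _ (onCopies_mem_unitary hU)

lemma Reachable.productState_unitary {z₀ : Fin r → S} {T : ℕ}
    {φ : (Fin n → Fin m) → S → ℂ} (h : Reachable z₀ T fun A => productState n m r (φ A))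
    {U : Matrix S S ℂ} (hU : U ∈ Matrix.unitaryGroup S ℂ) :
    Reachable z₀ T fun A => productState n m r (U *ᵥ φ A) := by
  simpa only [onCopies_mulVec] using h.unitary _ (onCopies_mem_unitary hU)

/-- The phase of the whole register is the product of the phases of the copies. `P` is known only
where the oracle registers hold `0`, which is enough since a product state vanishes elsewhere. -/
lemma Reachable.productState_phase {z₀ : Fin r → S} {T t : ℕ}
    {φ : (Fin n → Fin m) → S → ℂ} (h : Reachable z₀ T fun A => productState n m r (φ A))
    {P : (Fin n → Fin m) → Equiv.Perm (Register n m (Fin r → S))} (hP : QueryCircuit t P)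
    {p : (Fin n → Fin m) → S → S} (hp : ∀ A f, P A (0, 0, f) = (0, 0, fun l => p A (f l)))
    {d : S → ℂ} (hd : ∀ s, d s * star (d s) = 1) :
    Reachable z₀ (T + 2 * t) fun A =>
      productState n m r fun s => d (p A s) * φ A s := by
  have := h.phase hP (d := fun q => ∏ l, d (q.2.2 l)) fun q => by
    rw [star_prod, ← Finset.prod_mul_distrib]
    exact Finset.prod_eq_one fun l _ => hd _
  convert this using 3 with A q
  obtain ⟨x, b, f⟩ := q
  by_cases hq : x = 0 ∧ b = 0
  · obtain ⟨rfl, rfl⟩ := hq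
    simp only [productState, hp, and_self, if_true, Finset.prod_mul_distrib]
  · simp only [productState, hq, if_false, mul_zero]

end Copies

/-! ### Counting the occurrences of an entry by a linear scan -/

section Counting

variable {n m a : ℕ}

/-- Labels of the search register: index labels, padded to twice their number. -/
abbrev SearchLabel (n : ℕ) : Type := BitVec (Nat.clog 2 n) × Bool

/-- Labels of one copy of the search: search register, number of Grover iterations, copy of an
array entry, and a counter. -/
abbrev CopyLabel (n m a : ℕ) : Type :=
  SearchLabel n × Fin (2 ^ a) × BitVec (Nat.clog 2 m) × ZMod (2 ^ (Nat.clog 2 n + 1))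

/-- Exchange the oracle registers with the search register and the copy of an array entry. -/
def swapPerm (n m a : ℕ) : Equiv.Perm (Register n m (CopyLabel n m a)) :=
  Function.Involutive.toPerm
    (fun q => (q.2.2.1.1, q.2.2.2.2.1, (q.1, q.2.2.1.2), q.2.2.2.1, q.2.1, q.2.2.2.2.2))
    fun _ => rfl

/-- Add an index label to the index register. -/
def xorPerm (m a : ℕ) (x : BitVec (Nat.clog 2 n)) :
    Equiv.Perm (Register n m (CopyLabel n m a)) :=
  Function.Involutive.toPerm (fun q => (q.1 ^^^ x, q.2)) fun _ => by simp

/-- Increment the counter if the value register holds the copied array entry. -/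
def countPerm (n m a : ℕ) : Equiv.Perm (Register n m (CopyLabel n m a)) where
  toFun q := (q.1, q.2.1, q.2.2.1, q.2.2.2.1, q.2.2.2.2.1,
    q.2.2.2.2.2 + if q.2.1 = q.2.2.2.2.1 then 1 else 0)
  invFun q := (q.1, q.2.1, q.2.2.1, q.2.2.2.1, q.2.2.2.2.1,
    q.2.2.2.2.2 - if q.2.1 = q.2.2.2.2.1 then 1 else 0)
  left_inv q := by simp
  right_inv q := by simp

/-- Copy the array entry at the searched index. -/
def loadCircuit (a : ℕ) (A : Fin n → Fin m) : Equiv.Perm (Register n m (CopyLabel n m a)) :=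
  swapPerm n m a * (queryPerm _ A * swapPerm n m a)

/-- Compare the array entry at `j` with the copied entry, and count if they agree. -/
def compareCircuit (a : ℕ) (A : Fin n → Fin m) (j : Fin n) :
    Equiv.Perm (Register n m (CopyLabel n m a)) :=
  (xorPerm m a (BitVec.ofNat _ j) * queryPerm _ A) * (countPerm n m a *
    (queryPerm _ A * xorPerm m a (BitVec.ofNat _ j)))

/-- Copy the array entry at the searched index and count its occurrences in the array. -/
def countCircuit (a : ℕ) (A : Fin n → Fin m) : Equiv.Perm (Register n m (CopyLabel n m a)) :=
  ((List.finRange n).map fun j => compareCircuit a A j).prod * loadCircuit a A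

/-- Each comparison takes two queries, the second to clear the value register; loading the entry
takes one more. -/
lemma queryCircuit_countCircuit :
    QueryCircuit (n * 2 + 1) (countCircuit (n := n) (m := m) a) := by
  have h₁ : QueryCircuit 1 (loadCircuit (n := n) (m := m) a) :=
    (QueryCircuit.free _).mul (QueryCircuit.query.mul (.free _))
  have h₂ (j : Fin n) : QueryCircuit 2 fun A : Fin n → Fin m => compareCircuit a A j :=
    ((QueryCircuit.free _).mul .query).mul
      ((QueryCircuit.free _).mul (QueryCircuit.query.mul (.free _)))
  have h := (QueryCircuit.list_prod h₂ (List.finRange n)).mul h₁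
  rw [List.length_finRange] at h
  exact h

/-- The number of occurrences of a value label in the array. -/
def occurrences (A : Fin n → Fin m) (v : BitVec (Nat.clog 2 m)) : ℕ :=
  (List.finRange n).countP fun j : Fin n => queryValue A (BitVec.ofNat _ j) = v

lemma loadCircuit_apply (A : Fin n → Fin m) (x : SearchLabel n) (y : Fin (2 ^ a))
    (v : BitVec (Nat.clog 2 m)) (c : ZMod (2 ^ (Nat.clog 2 n + 1))) :
    loadCircuit a A (0, 0, x, y, v, c) = (0, 0, x, y, v ^^^ queryValue A x.1, c) := by
  simp [loadCircuit, swapPerm, Function.Involutive.toPerm, queryPerm]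

lemma compareCircuit_apply (A : Fin n → Fin m) (j : Fin n) (x : SearchLabel n)
    (y : Fin (2 ^ a)) (v : BitVec (Nat.clog 2 m)) (c : ZMod (2 ^ (Nat.clog 2 n + 1))) :
    compareCircuit a A j (0, 0, x, y, v, c) = (0, 0, x, y, v,
      c + if queryValue A (BitVec.ofNat _ j) = v then 1 else 0) := by
  simp [compareCircuit, xorPerm, countPerm, Function.Involutive.toPerm, queryPerm]

/-- The action of `countCircuit` when the oracle registers hold `0`. -/
def countMap (a : ℕ) (A : Fin n → Fin m) (s : CopyLabel n m a) : CopyLabel n m a :=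
  (s.1, s.2.1, s.2.2.1 ^^^ queryValue A s.1.1,
    s.2.2.2 + (occurrences A (s.2.2.1 ^^^ queryValue A s.1.1) : ℕ))

lemma countCircuit_apply (A : Fin n → Fin m) (s : CopyLabel n m a) :
    countCircuit a A (0, 0, s) = (0, 0, countMap a A s) := by
  have key (L : List (Fin n)) (x : SearchLabel n) (y : Fin (2 ^ a))
      (v : BitVec (Nat.clog 2 m)) (c : ZMod (2 ^ (Nat.clog 2 n + 1))) :
      (L.map fun j => compareCircuit a A j).prod (0, 0, x, y, v, c) = (0, 0, x, y, v,
        c + (L.countP fun j : Fin n => queryValue A (BitVec.ofNat _ j) = v : ℕ)) := by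
    induction L with
    | nil => simp
    | cons j L ih =>
      rw [List.map_cons, List.prod_cons, Equiv.Perm.mul_apply, ih, compareCircuit_apply,
        List.countP_cons, add_assoc]
      simp
  obtain ⟨x, y, v, c⟩ := s
  rw [countCircuit, Equiv.Perm.mul_apply, loadCircuit_apply, key]
  rfl

/-- The search labels of the indices whose array entry occurs at least `k` times. -/
def Marked (k : ℕ) (A : Fin n → Fin m) (x : SearchLabel n) : Prop :=
  x.1.toNat < n ∧ x.2 = false ∧ k ≤ occurrences A (queryValue A x.1)

/-- The labels of one copy that witness `k` identical entries. -/
def Accepted (k : ℕ) (s : CopyLabel n m a) : Prop :=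
  s.1.1.toNat < n ∧ s.1.2 = false ∧ k ≤ s.2.2.2.val

lemma occurrences_le (A : Fin n → Fin m) (v : BitVec (Nat.clog 2 m)) :
    occurrences A v ≤ n :=
  List.countP_le_length.trans_eq List.length_finRange

/-- Counts are at most `n`, below the modulus `2 ^ (Nat.clog 2 n + 1)` of the counter, so they never
wrap around. -/
lemma accepted_countMap {k : ℕ} (A : Fin n → Fin m) (x : SearchLabel n) (y : Fin (2 ^ a)) :
    Accepted k (countMap a A (x, y, 0, 0)) ↔ Marked k A x := by
  have h : occurrences A (queryValue A x.1) < 2 ^ (Nat.clog 2 n + 1) :=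
    ((occurrences_le A _).trans (Nat.le_pow_clog one_lt_two n)).trans_lt
      (Nat.pow_lt_pow_right one_lt_two (Nat.lt_succ_self _))
  simp only [Accepted, countMap, Marked]
  rw [BitVec.ofNat_eq_ofNat, BitVec.zero_xor, zero_add, ZMod.val_natCast, Nat.mod_eq_of_lt h]

lemma queryValue_ofNat (A : Fin n → Fin m) (j : Fin n) :
    queryValue A (BitVec.ofNat _ j) = BitVec.ofNat _ (A j) := by
  have h : (j : ℕ) % 2 ^ Nat.clog 2 n = j :=
    Nat.mod_eq_of_lt (j.2.trans_le (Nat.le_pow_clog one_lt_two n))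
  simp [queryValue, h]

lemma ofNat_clog_injective {m : ℕ} :
    Function.Injective fun i : Fin m => BitVec.ofNat (Nat.clog 2 m) i := fun i j h => by
  have := congrArg BitVec.toNat h
  have hlt (i : Fin m) : (i : ℕ) % 2 ^ Nat.clog 2 m = i :=
    Nat.mod_eq_of_lt (i.2.trans_le (Nat.le_pow_clog one_lt_two m))
  simp only [BitVec.toNat_ofNat, hlt] at this
  exact Fin.ext this

lemma occurrences_queryValue (A : Fin n → Fin m) (i : Fin n) :
    occurrences A (queryValue A (BitVec.ofNat _ i)) =
      (Finset.univ.filter fun j => A j = A i).card := by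
  have h (j : Fin n) : queryValue A (BitVec.ofNat _ j) = queryValue A (BitVec.ofNat _ i) ↔
      A j = A i := by
    rw [queryValue_ofNat, queryValue_ofNat]
    exact ofNat_clog_injective.eq_iff
  simp only [occurrences, h]
  rw [List.countP_eq_length_filter,
    ← List.toFinset_card_of_nodup ((List.nodup_finRange n).filter _)]
  congr 1
  ext j
  simp

lemma marked_ofNat {k : ℕ} (A : Fin n → Fin m) (i : Fin n) :
    Marked k A (BitVec.ofNat _ i, false) ↔
      k ≤ (Finset.univ.filter fun j => A j = A i).card := by
  have h : (i : ℕ) % 2 ^ Nat.clog 2 n = i :=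
    Nat.mod_eq_of_lt (i.2.trans_le (Nat.le_pow_clog one_lt_two n))
  simp only [Marked, occurrences_queryValue, BitVec.toNat_ofNat, h, i.2, true_and]

lemma marked_iff {k : ℕ} (A : Fin n → Fin m) (x : SearchLabel n) : Marked k A x ↔
    ∃ i : Fin n, x = (BitVec.ofNat _ i, false) ∧
      k ≤ (Finset.univ.filter fun j => A j = A i).card := by
  constructor
  · intro h
    have hx : x = (BitVec.ofNat _ (⟨x.1.toNat, h.1⟩ : Fin n), false) := by
      ext1 <;> simp [h.2.1]
    exact ⟨⟨x.1.toNat, h.1⟩, hx, (marked_ofNat A _).1 (hx ▸ h)⟩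
  · rintro ⟨i, rfl, h⟩
    exact (marked_ofNat A i).2 h

lemma kDistinct_iff {k : ℕ} (hk : 1 ≤ k) (A : Fin n → Fin m) :
    KDistinct A k ↔ ∃ i, k ≤ (Finset.univ.filter fun j => A j = A i).card := by
  constructor
  · rintro ⟨s, rfl, hs⟩
    obtain ⟨i, hi⟩ := Finset.card_pos.1 hk
    exact ⟨i, Finset.card_le_card fun j hj => by simpa using hs j hj i hi⟩
  · rintro ⟨i, hi⟩
    obtain ⟨s, hs, rfl⟩ := Finset.exists_subset_card_eq hi
    refine ⟨s, rfl, fun j hj l hl => ?_⟩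
    have h₁ := hs hj
    have h₂ := hs hl
    simp only [Finset.mem_filter] at h₁ h₂
    rw [h₁.2, h₂.2]

open Classical in
lemma card_marked_eq_zero {k : ℕ} (hk : 1 ≤ k) {A : Fin n → Fin m} (h : ¬ KDistinct A k) :
    (Finset.univ.filter (Marked k A)).card = 0 := by
  rw [Finset.card_eq_zero, Finset.filter_eq_empty_iff]
  intro x _ hx
  obtain ⟨i, -, hi⟩ := (marked_iff A x).1 hx
  exact h ((kDistinct_iff hk A).2 ⟨i, hi⟩)

-- All indices that share a frequent value are marked together; this is the source of the factor
-- `1/√k`.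
open Classical in
lemma le_card_marked {k : ℕ} (hk : 1 ≤ k) {A : Fin n → Fin m} (h : KDistinct A k) :
    k ≤ (Finset.univ.filter (Marked k A)).card := by
  obtain ⟨i, hi⟩ := (kDistinct_iff hk A).1 h
  refine hi.trans (Finset.card_le_card_of_injOn (fun j => (BitVec.ofNat _ j, false)) ?_ ?_)
  · intro j hj
    have hj : A j = A i := by simpa using hj
    simpa only [Finset.coe_filter, Finset.mem_univ, true_and, Set.mem_ofPred_eq, marked_ofNat,
      hj] using hi
  · intro j _ l _ hjl
    exact ofNat_clog_injective (congrArg Prod.fst hjl)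

-- Marked labels have padding bit `false`, so at most half of all search labels are marked.
open Classical in
lemma card_marked_le {k : ℕ} (A : Fin n → Fin m) :
    (Finset.univ.filter (Marked k A)).card ≤ 2 ^ Nat.clog 2 n := by
  have : Fintype.card (BitVec (Nat.clog 2 n)) = 2 ^ Nat.clog 2 n := by
    rw [Fintype.card_congr BitVec.equivFin.toEquiv, Fintype.card_fin]
  rw [← this, ← Finset.card_univ]
  refine Finset.card_le_card_of_injOn Prod.fst (fun _ _ => Finset.mem_univ _) ?_
  intro x hx y hy hxy
  simp only [Finset.coe_filter, Finset.mem_univ, true_and] at hx hy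
  exact Prod.ext hxy (hx.2.1.trans hy.2.1.symm)

lemma card_searchLabel : Fintype.card (SearchLabel n) = 2 * 2 ^ Nat.clog 2 n := by
  rw [Fintype.card_prod, Fintype.card_congr BitVec.equivFin.toEquiv, Fintype.card_fin,
    Fintype.card_bool, mul_comm]

lemma card_copyLabel : Fintype.card (CopyLabel n m a) =
    2 ^ (2 * (Nat.clog 2 n + 1) + a + Nat.clog 2 m) := by
  rw [Fintype.card_prod, card_searchLabel, Fintype.card_prod, Fintype.card_fin,
    Fintype.card_prod, Fintype.card_congr BitVec.equivFin.toEquiv, Fintype.card_fin, ZMod.card]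
  ring

end Counting

/-! ### Reflections and block-diagonal unitaries -/

section Reflections

variable {X : Type} [Fintype X]

lemma blockDiagonal_mulVec {O : Type} [Fintype O] [DecidableEq O] (M : O → Matrix X X ℂ)
    (φ : X × O → ℂ) (x : X) (o : O) :
    (Matrix.blockDiagonal M *ᵥ φ) (x, o) = (M o *ᵥ fun x' => φ (x', o)) x := by
  simp [Matrix.mulVec, dotProduct, Fintype.sum_prod_type, Matrix.blockDiagonal_apply]

variable [DecidableEq X]

/-- The reflection that fixes a nonzero real vector `u` and negates its orthogonal complement. -/
def reflectionMatrix (u : X → ℝ) : Matrix X X ℂ :=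
  (Matrix.of fun x y => 2 / (∑ z, u z ^ 2) * (u x * u y) - if x = y then 1 else 0 :
    Matrix X X ℝ).map Complex.ofReal

lemma reflectionMatrix_mulVec (u φ : X → ℝ) :
    reflectionMatrix u *ᵥ (fun x => (φ x : ℂ)) =
      fun x => ((2 / (∑ z, u z ^ 2) * (∑ y, u y * φ y) * u x - φ x : ℝ) : ℂ) := by
  funext x
  simp only [reflectionMatrix, Matrix.mulVec, dotProduct, Matrix.map_apply, Matrix.of_apply,
    ← Complex.ofReal_mul, ← Complex.ofReal_sum, sub_mul, Finset.sum_sub_distrib, ite_mul, one_mul,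
    zero_mul, Finset.sum_ite_eq, Finset.mem_univ, if_true]
  congr 2
  rw [Finset.mul_sum, Finset.sum_mul]
  exact Finset.sum_congr rfl fun y _ => by ring

lemma reflectionMatrix_mem_unitary {u : X → ℝ} (hu : ∑ z, u z ^ 2 ≠ 0) :
    reflectionMatrix u ∈ Matrix.unitaryGroup X ℂ := by
  set c := ∑ z, u z ^ 2 with hc
  set R : Matrix X X ℝ := Matrix.of fun x y => 2 / c * (u x * u y) - if x = y then 1 else 0
    with hR
  have hmul : R * R = 1 := by
    ext x y
    have h₁ : ∑ z, (2 / c * (u x * u z)) * (2 / c * (u z * u y)) =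
        2 * (2 / c * (u x * u y)) := by
      have : ∀ z, (2 / c * (u x * u z)) * (2 / c * (u z * u y)) =
          2 / c * (2 / c) * (u x * u y) * u z ^ 2 := fun z => by ring
      rw [Finset.sum_congr rfl fun z _ => this z, ← Finset.mul_sum, ← hc]
      field_simp
    simp only [hR, Matrix.mul_apply, Matrix.of_apply, sub_mul, mul_sub, Finset.sum_sub_distrib,
      h₁, Matrix.one_apply]
    simp
    ring
  have hstar : star (reflectionMatrix u) = reflectionMatrix u := by
    ext x y
    simp only [reflectionMatrix, Matrix.star_apply, Matrix.map_apply, Matrix.of_apply,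
      RCLike.star_def, Complex.conj_ofReal, mul_comm (u y), eq_comm (a := y)]
  rw [Matrix.mem_unitaryGroup_iff, hstar]
  change R.map Complex.ofRealHom * R.map Complex.ofRealHom = 1
  rw [← Matrix.map_mul, hmul]
  simp

/-- A real unit vector is the image of a basis vector under a unitary. -/
lemma exists_unitary_mulVec_single (ψ : X → ℝ) (hψ : ∑ x, ψ x ^ 2 = 1) (x₀ : X)
    (h₀ : 0 ≤ ψ x₀) : ∃ U ∈ Matrix.unitaryGroup X ℂ,
      U *ᵥ Pi.single x₀ 1 = fun x => (ψ x : ℂ) := by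
  set e : X → ℝ := Pi.single x₀ 1 with he
  have hex : ∑ x, e x * ψ x = ψ x₀ := by simp [he, Pi.single_apply]
  have hee : ∑ x, e x ^ 2 = 1 := by simp [he, Pi.single_apply]
  have hc : ∑ x, (e x + ψ x) ^ 2 = 2 * (1 + ψ x₀) := by
    have : ∀ x, (e x + ψ x) ^ 2 = e x ^ 2 + 2 * (e x * ψ x) + ψ x ^ 2 := fun x => by ring
    simp only [this, Finset.sum_add_distrib, ← Finset.mul_sum, hex, hee, hψ]
    ring
  have hd : ∑ x, (e x + ψ x) * e x = 1 + ψ x₀ := by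
    have : ∀ x, (e x + ψ x) * e x = e x ^ 2 + e x * ψ x := fun x => by ring
    simp only [this, Finset.sum_add_distrib, hex, hee]
  have hpos : 0 < 1 + ψ x₀ := by linarith
  -- The reflection along the bisector `e + ψ` exchanges the two unit vectors; `h₀` ensures that the
  -- bisector is nonzero.
  refine ⟨_, reflectionMatrix_mem_unitary (u := fun x => e x + ψ x)
    (by rw [hc]; positivity), ?_⟩
  have hs : (Pi.single x₀ 1 : X → ℂ) = fun x => (e x : ℂ) := by
    funext x
    by_cases hx : x = x₀ <;> simp [he, hx]
  rw [hs, reflectionMatrix_mulVec, hc, hd]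
  funext x
  congr 1
  field_simp
  ring

lemma blockDiagonal_mem_unitary {O : Type} [Fintype O] [DecidableEq O] {M : O → Matrix X X ℂ}
    (hM : ∀ o, M o ∈ Matrix.unitaryGroup X ℂ) :
    Matrix.blockDiagonal M ∈ Matrix.unitaryGroup (X × O) ℂ := by
  rw [Matrix.mem_unitaryGroup_iff, Matrix.star_eq_conjTranspose,
    Matrix.blockDiagonal_conjTranspose, ← Matrix.blockDiagonal_mul, ← Matrix.blockDiagonal_one]
  congr 1
  funext o
  exact Matrix.mem_unitaryGroup_iff.1 (hM o)

end Reflections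

/-! ### Grover iterations with their number in superposition -/

section Grover

/-- Amplitudes of the marked and of the unmarked labels after some Grover iterations, relative
to the uniform state, when a fraction `ε` of the labels is marked. -/
def groverAmplitude (ε : ℝ) : ℕ → ℝ × ℝ
  | 0 => (1, 1)
  | j + 1 =>
    ((1 - 2 * ε) * (groverAmplitude ε j).1 + 2 * (1 - ε) * (groverAmplitude ε j).2,
      (1 - 2 * ε) * (groverAmplitude ε j).2 - 2 * ε * (groverAmplitude ε j).1)

/-- Each iteration is a rotation by `2θ`. The factors `sin θ` and `cos θ` stay on the left because
either may vanish. -/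
lemma groverAmplitude_trig (θ : ℝ) (j : ℕ) :
    Real.sin θ * (groverAmplitude (Real.sin θ ^ 2) j).1 = Real.sin ((2 * j + 1) * θ) ∧
      Real.cos θ * (groverAmplitude (Real.sin θ ^ 2) j).2 = Real.cos ((2 * j + 1) * θ) := by
  induction j with
  | zero => simp [groverAmplitude]
  | succ j ih =>
    have h : (2 * ((j + 1 : ℕ) : ℝ) + 1) * θ = (2 * j + 1) * θ + 2 * θ := by push_cast; ring
    rw [h, Real.sin_add, Real.cos_add, ← ih.1, ← ih.2, Real.cos_two_mul, Real.sin_two_mul]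
    have hc : Real.cos θ ^ 2 = 1 - Real.sin θ ^ 2 := Real.cos_sq' θ
    simp only [groverAmplitude]
    generalize (groverAmplitude (Real.sin θ ^ 2) j).1 = p
    generalize (groverAmplitude (Real.sin θ ^ 2) j).2 = q
    constructor
    · linear_combination (-2 * Real.sin θ * p - 2 * Real.sin θ * q) * hc
    · linear_combination (-2 * Real.cos θ * q) * hc

/-- The failure probability, averaged over the number of iterations below `M`, is at most
`3 / 4`. -/
lemma sum_cos_sq_le {θ : ℝ} {M : ℕ} (hs : 0 < Real.sin (2 * θ)) (hM : 1 ≤ M * Real.sin (2 * θ)) :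
    ∑ j ∈ Finset.range M, Real.cos ((2 * j + 1) * θ) ^ 2 ≤ 3 / 4 * M := by
  -- Multiplied by `4 sin 2θ`, the oscillating part of `cos²` telescopes: `2 sin 2θ cos (2(2K+1)θ) =
  -- sin (4(K+1)θ) - sin (4Kθ)`.
  have key (K : ℕ) : 4 * Real.sin (2 * θ) * ∑ j ∈ Finset.range K, Real.cos ((2 * j + 1) * θ) ^ 2 =
      2 * Real.sin (2 * θ) * K + Real.sin (4 * K * θ) := by
    induction K with
    | zero => simp
    | succ K ih =>
      rw [Finset.sum_range_succ, mul_add, ih]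
      have h₁ : Real.sin (4 * (K + 1 : ℕ) * θ) =
          Real.sin (2 * ((2 * K + 1) * θ) + 2 * θ) := by push_cast; ring_nf
      have h₂ : Real.sin (4 * K * θ) = Real.sin (2 * ((2 * K + 1) * θ) - 2 * θ) := by ring_nf
      rw [h₁, h₂, Real.sin_add, Real.sin_sub, Real.cos_two_mul ((2 * K + 1) * θ)]
      push_cast
      ring
  have h := key M
  have h₁ := Real.sin_le_one (4 * M * θ)
  by_contra! hlt
  have := mul_lt_mul_of_pos_left hlt hs
  nlinarith

variable {X Z : Type} [Fintype X] {M : ℕ}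

/-- The state of the search after `τ` rounds: the label `y : Fin M` is the number of Grover
iterations that are carried out, and further rounds do nothing. -/
def groverState [DecidableEq Z] (z₀ : Z) (G : X → Prop) [DecidablePred G] (τ : ℕ)
    (s : X × Fin M × Z) : ℝ :=
  if s.2.2 = z₀ then
    (if G s.1 then
      (groverAmplitude ((Finset.univ.filter G).card / Fintype.card X) (min τ s.2.1)).1
    else (groverAmplitude ((Finset.univ.filter G).card / Fintype.card X) (min τ s.2.1)).2) /
      Real.sqrt (Fintype.card X * M)
  else 0

/-- One Grover diffusion on the branches that carry out more than `τ` iterations. -/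
def diffusionMatrix [DecidableEq X] [DecidableEq Z] (τ : ℕ) :
    Matrix (X × Fin M × Z) (X × Fin M × Z) ℂ :=
  Matrix.blockDiagonal fun o => if τ < o.1 then reflectionMatrix fun _ => 1 else 1

lemma sum_ite_marked (G : X → Prop) [DecidablePred G] (p q : ℝ) :
    ∑ x, (if G x then p else q) = (Finset.univ.filter G).card * p +
      (Fintype.card X - (Finset.univ.filter G).card) * q := by
  have h := Finset.card_filter_add_card_filter_not (s := Finset.univ) G
  have h : ((Finset.univ.filter fun x => ¬ G x).card : ℝ) =
      Fintype.card X - (Finset.univ.filter G).card := by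
    rw [eq_sub_iff_add_eq', ← Nat.cast_add, h, Finset.card_univ]
  rw [Finset.sum_ite, Finset.sum_const, Finset.sum_const, nsmul_eq_mul, nsmul_eq_mul, h]

lemma sum_groverState_sq [Fintype Z] [DecidableEq Z] (z₀ : Z) (G : X → Prop)
    [DecidablePred G] (W : X → ℝ) :
    ∑ s : X × Fin M × Z, W s.1 * groverState z₀ G M s ^ 2 =
      (∑ y ∈ Finset.range M, ∑ x, W x * (if G x then
        (groverAmplitude ((Finset.univ.filter G).card / Fintype.card X) y).1 else
        (groverAmplitude ((Finset.univ.filter G).card / Fintype.card X) y).2) ^ 2) /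
      (Fintype.card X * M) := by
  rw [← Fin.sum_univ_eq_sum_range (fun y => ∑ x, W x * (if G x then
        (groverAmplitude ((Finset.univ.filter G).card / Fintype.card X) y).1 else
        (groverAmplitude ((Finset.univ.filter G).card / Fintype.card X) y).2) ^ 2),
    Finset.sum_comm, Fintype.sum_prod_type, Finset.sum_div]
  refine Finset.sum_congr rfl fun x _ => ?_
  rw [Fintype.sum_prod_type, Finset.sum_div]
  refine Finset.sum_congr rfl fun y _ => ?_
  rw [Finset.sum_eq_single z₀]
  · rw [groverState, if_pos rfl, div_pow, Real.sq_sqrt (by positivity), min_eq_right y.2.le,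
      mul_div_assoc]
  · intro z _ hz
    simp [groverState, hz]
  · simp

variable [Nonempty X]

lemma diffusionMatrix_mem_unitary [DecidableEq X] [Fintype Z] [DecidableEq Z] (τ : ℕ) :
    (diffusionMatrix τ : Matrix (X × Fin M × Z) _ ℂ) ∈ Matrix.unitaryGroup _ ℂ := by
  refine blockDiagonal_mem_unitary fun o => ?_
  split_ifs
  · exact reflectionMatrix_mem_unitary (by simp)
  · exact one_mem _

variable [Fintype Z] [DecidableEq Z] (z₀ : Z) (G : X → Prop) [DecidablePred G]

/-- Diffusion sends each amplitude to twice the mean minus itself. Branches with `y ≤ τ` get neither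
phase nor diffusion, so `min τ y` stays put. The phase `d` matters only at `z₀`, where the state is
supported. -/
lemma diffusionMatrix_mulVec [DecidableEq X] (τ : ℕ) {d : X × Fin M × Z → ℂ}
    (hd : ∀ x y, d (x, y, z₀) = if G x ∧ τ < y then -1 else 1) :
    diffusionMatrix τ *ᵥ (fun s => d s * (groverState z₀ G τ s : ℂ)) =
      fun s => (groverState z₀ G (τ + 1) s : ℂ) := by
  funext ⟨x, y, z⟩
  rw [diffusionMatrix, blockDiagonal_mulVec]
  by_cases hz : z = z₀
  swap
  · have h : (fun x' : X => d (x', y, z) * (groverState z₀ G τ (x', y, z) : ℂ)) = 0 := by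
      funext x'
      simp [groverState, hz]
    rw [h, Matrix.mulVec_zero]
    simp [groverState, hz]
  subst hz
  by_cases hy : τ < y
  · set t : ℝ := ((Finset.univ.filter G).card : ℝ) with ht
    set N : ℝ := (Fintype.card X : ℝ) with hN
    have hN0 : N ≠ 0 := by simp [hN]
    set p := (groverAmplitude (t / N) τ).1 with hp
    set q := (groverAmplitude (t / N) τ).2 with hq
    have h : (fun x' : X => d (x', y, z) * (groverState z G τ (x', y, z) : ℂ)) =
        fun x' => (((if G x' then -p / Real.sqrt (N * M) else q / Real.sqrt (N * M)) : ℝ) : ℂ) := by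
      funext x'
      rw [hd, groverState]
      simp only [if_true, hy, and_true, min_eq_left hy.le, ← ht, ← hN, ← hp, ← hq]
      split_ifs <;> simp [neg_div]
    simp only [hy, if_true]
    rw [h, reflectionMatrix_mulVec]
    simp only [one_pow, one_mul, mul_one, sum_ite_marked, Finset.sum_const, Finset.card_univ,
      nsmul_eq_mul, ← ht, ← hN]
    have h1 : min (τ + 1) (y : ℕ) = τ + 1 := min_eq_left hy
    congr 1
    simp only [groverState, if_true, h1, groverAmplitude, ← ht, ← hN, ← hp, ← hq]
    split_ifs
    · field_simp
      ring
    · field_simp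
      ring
  · have h : (fun x' : X => d (x', y, z) * (groverState z G τ (x', y, z) : ℂ)) =
        fun x' => (groverState z G (τ + 1) (x', y, z) : ℂ) := by
      funext x'
      have h1 : min (τ + 1) (y : ℕ) = min τ y := by omega
      simp [hd, hy, groverState, h1]
    simp only [hy, if_false]
    rw [h, Matrix.one_mulVec]

/-- The rotation angle of the Grover iteration. -/
lemma exists_angle : ∃ θ : ℝ, 0 ≤ θ ∧ θ ≤ Real.pi / 2 ∧
    Real.sin θ ^ 2 = (Finset.univ.filter G).card / Fintype.card X := by
  have hN : (0 : ℝ) < Fintype.card X := by exact_mod_cast Fintype.card_pos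
  set ε : ℝ := (Finset.univ.filter G).card / Fintype.card X
  have h0 : 0 ≤ ε := by positivity
  have h1 : ε ≤ 1 := by
    rw [div_le_one hN]
    exact_mod_cast Finset.card_le_univ _
  refine ⟨Real.arcsin (Real.sqrt ε), Real.arcsin_nonneg.2 (Real.sqrt_nonneg _),
    Real.arcsin_le_pi_div_two _, ?_⟩
  rw [Real.sin_arcsin (by linarith [Real.sqrt_nonneg ε]) (Real.sqrt_le_one.2 h1), Real.sq_sqrt h0]

lemma sum_groverState_sq_eq_one (hM : 0 < M) :
    ∑ s : X × Fin M × Z, groverState z₀ G M s ^ 2 = 1 := by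
  have h := sum_groverState_sq (M := M) z₀ G fun _ => 1
  simp only [one_mul] at h
  obtain ⟨θ, -, -, hθ⟩ := exists_angle G
  have hN : (Fintype.card X : ℝ) ≠ 0 := by simp
  have ht : ((Finset.univ.filter G).card : ℝ) = Real.sin θ ^ 2 * Fintype.card X := by
    rw [hθ, div_mul_cancel₀ _ hN]
  rw [h, ← hθ, Finset.sum_congr rfl (g := fun _ => (Fintype.card X : ℝ))]
  · rw [Finset.sum_const, Finset.card_range, nsmul_eq_mul, mul_comm, div_self]
    positivity
  · intro y _
    simp only [ite_pow, sum_ite_marked, ht]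
    obtain ⟨h₁, h₂⟩ := groverAmplitude_trig θ y
    have h₃ := Real.sin_sq_add_cos_sq ((2 * y + 1) * θ)
    rw [← h₁, ← h₂, mul_pow, mul_pow, Real.cos_sq' θ] at h₃
    linear_combination (Fintype.card X : ℝ) * h₃

lemma sum_groverState_unmarked {θ : ℝ}
    (hθ : Real.sin θ ^ 2 = (Finset.univ.filter G).card / Fintype.card X) :
    ∑ s : X × Fin M × Z, (if ¬ G s.1 then groverState z₀ G M s ^ 2 else 0) =
      (∑ j ∈ Finset.range M, Real.cos ((2 * j + 1) * θ) ^ 2) / M := by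
  have h := sum_groverState_sq (M := M) z₀ G fun x => if ¬ G x then 1 else 0
  simp only [ite_mul, one_mul, zero_mul] at h
  have hN : (Fintype.card X : ℝ) ≠ 0 := by simp
  have ht : ((Finset.univ.filter G).card : ℝ) = Real.sin θ ^ 2 * Fintype.card X := by
    rw [hθ, div_mul_cancel₀ _ hN]
  rw [h, ← hθ, Finset.sum_congr rfl
    (g := fun j : ℕ => (Fintype.card X : ℝ) * Real.cos ((2 * j + 1) * θ) ^ 2),
    ← Finset.mul_sum, mul_div_mul_left _ _ hN]
  intro j _
  have h' (x : X) (p q : ℝ) : (if ¬ G x then (if G x then p else q) ^ 2 else 0) =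
      if G x then 0 else q ^ 2 := by split_ifs <;> rfl
  simp only [h', sum_ite_marked, ht]
  rw [← (groverAmplitude_trig θ j).2, mul_pow, Real.cos_sq' θ]
  ring

end Grover

/-! ### The search algorithm and its success probability -/

section Algorithm

lemma groverState_zero {X Z : Type} [Fintype X] [DecidableEq Z] {M : ℕ} (z₀ : Z) (G : X → Prop)
    [DecidablePred G] (s : X × Fin M × Z) : groverState z₀ G 0 s =
      if s.2.2 = z₀ then 1 / Real.sqrt (Fintype.card X * M) else 0 := by
  simp [groverState, groverAmplitude]

lemma sum_groverState_zero_sq {X Z : Type} [Fintype X] [Nonempty X] [Fintype Z] [DecidableEq Z]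
    {M : ℕ} (hM : 0 < M) (z₀ : Z) (G : X → Prop) [DecidablePred G] :
    ∑ s : X × Fin M × Z, groverState z₀ G 0 s ^ 2 = 1 := by
  have hN : (0 : ℝ) < Fintype.card X := by exact_mod_cast Fintype.card_pos
  have hM' : (0 : ℝ) < M := by exact_mod_cast hM
  simp only [groverState_zero, ite_pow, Fintype.sum_prod_type, div_pow, one_pow,
    Real.sq_sqrt (mul_pos hN hM').le, ne_eq, OfNat.ofNat_ne_zero, not_false_eq_true, zero_pow,
    Finset.sum_ite_eq', Finset.mem_univ, if_true, Finset.sum_const, Finset.card_univ,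
    Fintype.card_fin, nsmul_eq_mul]
  field_simp

/-- With `ε = t / N ≤ 1/2`, `sin² 2θ = 4ε(1 - ε) ≥ 2ε`, and the last hypothesis says `2εM² ≥ 1`. -/
lemma one_le_mul_sin {t N M θ : ℝ} (hN : 0 < N) (hM : 0 ≤ M) (h₀ : 0 ≤ θ)
    (h₁ : θ ≤ Real.pi / 2) (hθ : Real.sin θ ^ 2 = t / N) (ht : 2 * t ≤ N)
    (h : N ≤ 2 * t * M ^ 2) : 1 ≤ M * Real.sin (2 * θ) := by
  have hs : 0 ≤ Real.sin (2 * θ) := Real.sin_nonneg_of_nonneg_of_le_pi (by linarith) (by linarith)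
  have hsq : Real.sin (2 * θ) ^ 2 = 4 * (t / N) * (1 - t / N) := by
    rw [Real.sin_two_mul, mul_pow, mul_pow, Real.cos_sq', hθ]
    ring
  have hε : t / N ≤ 1 / 2 := by rw [div_le_div_iff₀ hN two_pos]; linarith
  have hε' : 1 ≤ 2 * (t / N) * M ^ 2 := by
    have : 2 * (t / N) * M ^ 2 = 2 * t * M ^ 2 / N := by ring
    rw [this, one_le_div hN]
    exact h
  have hpos : 0 ≤ t / N := by rw [← hθ]; positivity
  have : 1 ≤ (M * Real.sin (2 * θ)) ^ 2 := by
    rw [mul_pow, hsq]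
    nlinarith [mul_nonneg (mul_nonneg hpos (sq_nonneg M)) (sub_nonneg.2 hε)]
  exact (one_le_sq_iff₀ (mul_nonneg hM hs)).1 this

variable {n m : ℕ}

open Classical in
lemma reachable_groverState (k a r : ℕ) (τ : ℕ)
    {P : (Fin n → Fin m) → Equiv.Perm (Register n m (Fin r → CopyLabel n m a))} {t : ℕ}
    (hP : QueryCircuit t P)
    (hp : ∀ A f, P A (0, 0, f) = (0, 0, fun l => countMap a A (f l))) :
    Reachable (fun _ => (((0, false), 0, 0, 0) : CopyLabel n m a)) (τ * (2 * t)) fun A =>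
      productState n m r fun s => (groverState 0 (Marked k A) τ s : ℂ) := by
  induction τ with
  | zero =>
    rw [Nat.zero_mul]
    obtain ⟨U, hU, h⟩ := exists_unitary_mulVec_single
      -- The initial uniform state does not depend on the marking, so an empty one stands in for it
      -- and the unitary does not depend on `A`.
      (fun s : CopyLabel n m a => groverState 0 (fun _ => False) 0 s)
      (sum_groverState_zero_sq (by positivity) _ _) ((0, false), 0, 0, 0)
      (by rw [groverState_zero]; split_ifs <;> positivity)
    have := Reachable.productState_init (n := n) (m := m) (r := r) hU ((0, false), 0, 0, 0)
    rw [h] at this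
    simpa only [groverState_zero] using this
  | succ τ ih =>
    let d : CopyLabel n m a → ℂ := fun s => if Accepted k s ∧ τ < (s.2.1 : ℕ) then -1 else 1
    have hd (s : CopyLabel n m a) : d s * star (d s) = 1 := by
      simp only [d]
      split_ifs <;> simp
    have := (ih.productState_phase hP hp hd).productState_unitary
      (diffusionMatrix_mem_unitary τ)
    rw [Nat.succ_mul]
    convert this using 2 with A
    rw [← diffusionMatrix_mulVec 0 (Marked k A) τ (d := fun s => d (countMap a A s))]
    intro x y
    have h := accepted_countMap (k := k) A x y
    simp only [d]
    congr 1
    exact propext (and_congr_left fun _ => h)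

open Classical in
/-- Grover search for an index whose array entry occurs at least `k` times, on `r` copies. -/
theorem exists_search_algorithm {k : ℕ} (hk : 1 ≤ k) (m a r : ℕ)
    (ha : 2 ^ Nat.clog 2 n ≤ k * (2 ^ a) ^ 2) :
    ∃ 𝒜 : QueryAlgorithm n m,
      𝒜.workQubits = (2 * (Nat.clog 2 n + 1) + a + Nat.clog 2 m) * r ∧
      𝒜.queries = 2 ^ a * (2 * (r * (n * 2 + 1))) + r * (n * 2 + 1) ∧
      ∀ A, 1 - (3 / 4) ^ r ≤ 𝒜.probAnswer A (decide (KDistinct A k)) := by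
  obtain ⟨P, hP, hp⟩ := (queryCircuit_countCircuit (n := n) (m := m) (a := a)).exists_allCopies
    countCircuit_apply r
  obtain ⟨𝒜, hw, hq, hprob⟩ :=
    -- After `2 ^ a` rounds every branch has finished. A last forward run of `P` writes the counts,
    -- so the measurement checks its own witness.
    ((reachable_groverState k a r (2 ^ a) hP hp).circuit hP.inv).exists_algorithm
      (w := (2 * (Nat.clog 2 n + 1) + a + Nat.clog 2 m) * r)
      (by rw [Fintype.card_fun, card_copyLabel, Fintype.card_fin, pow_mul])
      fun q => decide (∃ l, Accepted k (q.2.2 l))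
  refine ⟨𝒜, hw, hq, fun A => ?_⟩
  set M := 2 ^ a with hM
  have hMpos : 0 < M := by positivity
  have hfalse : 𝒜.probAnswer A false =
      (∑ s : CopyLabel n m a, if ¬ Marked k A s.1 then groverState 0 (Marked k A) M s ^ 2
        else 0) ^ r := by
    rw [hprob]
    have := sum_norm_sq_comp_inv (hp A) (fun s => (groverState 0 (Marked k A) M s : ℂ))
      (Accepted k)
    simp only [decide_eq_false_iff_not, not_exists]
    rw [this]
    congr 1
    refine Finset.sum_congr rfl fun s _ => ?_
    obtain ⟨x, y, z⟩ := s
    by_cases hz : z = 0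
    · subst hz
      have h := accepted_countMap (k := k) A x y
      rw [Complex.norm_real, Real.norm_eq_abs, sq_abs]
      congr 1
      exact propext (not_congr h)
    · simp [groverState, hz]
  have htotal : 𝒜.probAnswer A true + 𝒜.probAnswer A false = 1 := by
    rw [hprob, hprob, ← Finset.sum_add_distrib]
    have := sum_norm_sq_comp_perm (P A)⁻¹ fun s => (groverState 0 (Marked k A) M s : ℂ)
    simp only [Complex.norm_real, Real.norm_eq_abs, sq_abs] at this
    rw [sum_groverState_sq_eq_one _ _ hMpos, one_pow] at this
    rw [← this]
    refine Finset.sum_congr rfl fun q _ => ?_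
    by_cases h : ∃ l, Accepted k (q.2.2 l) <;> simp [h, hM]
  obtain ⟨θ, hθ₀, hθ₁, hθ⟩ := exists_angle (Marked k A)
  rw [sum_groverState_unmarked 0 _ hθ] at hfalse
  have hM' : (0 : ℝ) < M := by exact_mod_cast hMpos
  by_cases hA : KDistinct A k
  · have ht : (k : ℝ) ≤ (Finset.univ.filter (Marked k A)).card := by
      exact_mod_cast le_card_marked hk hA
    have ht' : ((Finset.univ.filter (Marked k A)).card : ℝ) ≤ 2 ^ Nat.clog 2 n := by
      exact_mod_cast card_marked_le A
    have hN : (Fintype.card (SearchLabel n) : ℝ) = 2 * 2 ^ Nat.clog 2 n := by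
      rw [card_searchLabel]
      push_cast
      rfl
    have ha' : (2 : ℝ) ^ Nat.clog 2 n ≤ k * (M : ℝ) ^ 2 := by exact_mod_cast ha
    have hsin := one_le_mul_sin (M := M) (by rw [hN]; positivity) (by positivity) hθ₀ hθ₁ hθ
      (by rw [hN]; linarith) (by rw [hN]; nlinarith [sq_nonneg (M : ℝ)])
    have hs : 0 < Real.sin (2 * θ) := by
      by_contra! h
      nlinarith
    have hle := sum_cos_sq_le hs hsin
    have : 𝒜.probAnswer A false ≤ (3 / 4) ^ r := by
      rw [hfalse]
      refine pow_le_pow_left₀ (by positivity) ?_ r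
      rwa [div_le_iff₀ hM']
    simp only [hA, decide_true]
    linarith
  -- Without marked labels the angle is `0` and the answer `false` is certain: the error is
  -- one-sided.
  · rw [card_marked_eq_zero hk hA, Nat.cast_zero, zero_div, sq_eq_zero_iff] at hθ
    have hcos (j : ℕ) : Real.cos ((2 * j + 1) * θ) ^ 2 = 1 := by
      have hθ' : θ = 0 := by
        by_contra h
        have := Real.sin_pos_of_pos_of_lt_pi (lt_of_le_of_ne hθ₀ (Ne.symm h))
          (by linarith [Real.pi_pos])
        exact this.ne' hθ
      simp [hθ']
    simp only [hcos, Finset.sum_const, Finset.card_range, nsmul_eq_mul, mul_one,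
      ← hM] at hfalse
    rw [div_self hM'.ne', one_pow] at hfalse
    simp only [hA, decide_false, hfalse]
    linarith [pow_nonneg (by norm_num : (0 : ℝ) ≤ 3 / 4) r]

end Algorithm

/-! ### Numerical bounds -/

section Bounds

lemma pow_clog_le {n : ℕ} (hn : 1 ≤ n) : 2 ^ Nat.clog 2 n ≤ 2 * n := by
  rcases hn.eq_or_lt with rfl | hn
  · simp
  · have h := Nat.pow_pred_clog_lt_self one_lt_two hn
    have hpos : 0 < Nat.clog 2 n := Nat.clog_pos one_lt_two hn
    obtain ⟨c, hc⟩ : ∃ c, Nat.clog 2 n = c + 1 := ⟨_, (Nat.succ_pred_eq_of_pos hpos).symm⟩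
    rw [hc, Nat.pred_succ] at h
    rw [hc, pow_succ]
    omega

lemma half_le_log_two : (1 : ℝ) / 2 ≤ Real.log 2 := by
  linarith [Real.log_two_gt_d9]

lemma clog_le_log {n : ℕ} (hn : 1 ≤ n) : (Nat.clog 2 n : ℝ) ≤ 4 * Real.log n := by
  rcases hn.eq_or_lt with rfl | h2
  · simp
  · have h : (2 : ℝ) ^ Nat.clog 2 n ≤ 2 * n := by exact_mod_cast pow_clog_le hn
    have hn' : (2 : ℝ) ≤ n := by exact_mod_cast h2
    have := Real.log_le_log (by positivity) h
    rw [Real.log_pow, Real.log_mul two_ne_zero (by linarith)] at this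
    have h₁ := Real.log_le_log two_pos hn'
    nlinarith [half_le_log_two, Nat.cast_nonneg (α := ℝ) (Nat.clog 2 n)]

/-- The range of iteration numbers for the Grover search. -/
lemma exists_iteration_bound {n k : ℕ} (hk : 2 ≤ k) (hkn : k ≤ n) :
    ∃ a : ℕ, 2 ^ Nat.clog 2 n ≤ k * (2 ^ a) ^ 2 ∧ k * (2 ^ a) ^ 2 ≤ 8 * n ∧
      a ≤ Nat.clog 2 n + 1 := by
  have hn := pow_clog_le (show 1 ≤ n by omega)
  have hex : ∃ a : ℕ, 2 ^ Nat.clog 2 n ≤ k * (2 ^ a) ^ 2 := by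
    refine ⟨Nat.clog 2 n, ?_⟩
    have : 1 ≤ 2 ^ Nat.clog 2 n := Nat.one_le_two_pow
    nlinarith
  obtain ⟨a, ha, hmin⟩ : ∃ a : ℕ, 2 ^ Nat.clog 2 n ≤ k * (2 ^ a) ^ 2 ∧
      ∀ b < a, ¬ 2 ^ Nat.clog 2 n ≤ k * (2 ^ b) ^ 2 := by
    classical
    exact ⟨Nat.find hex, Nat.find_spec hex, fun b hb => Nat.find_min hex hb⟩
  rcases a with _ | b
  · exact ⟨0, ha, by simp; omega, by omega⟩
  · have hb := hmin b (Nat.lt_succ_self b)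
    push Not at hb
    -- By minimality `k * (2 ^ b) ^ 2 < 2 ^ Nat.clog 2 n ≤ 2 * n`; one more doubling costs a factor
    -- `4`, whence `8 * n`.
    have hsq : (2 ^ (b + 1)) ^ 2 = 4 * (2 ^ b) ^ 2 := by ring
    refine ⟨b + 1, ha, by rw [hsq]; linarith, ?_⟩
    have h₁ : 1 ≤ 2 ^ b := Nat.one_le_two_pow
    have h₂ : 2 ^ b < 2 ^ Nat.clog 2 n := by nlinarith
    have := (Nat.pow_lt_pow_iff_right one_lt_two).1 h₂
    omega

end Bounds

end

/-! ### Choice of parameters -/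

theorem mainTheorem4 :
    ∃ C : ℝ, 0 < C ∧
      ∀ (n m k : ℕ) (δ : ℝ), 1 ≤ m → 1 ≤ k → k ≤ n → 0 < δ → δ < 1 / 2 →
        ∃ 𝒜 : QueryAlgorithm n m,
          𝒜.SolvesKDistinctness k δ ∧
          (𝒜.queries : ℝ) ≤
            C * ((n : ℝ) ^ (3 / 2 : ℝ) / Real.sqrt k * Real.log (n / (δ * k))) ∧
          (𝒜.qubits : ℝ) ≤
            C * ((Real.log m + Real.log n) * Real.log (n / (δ * k))) := by
  refine ⟨200, by norm_num, fun n m k δ hm hk hkn hδ hδ' => ?_⟩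
  have hk' : (1 : ℝ) ≤ k := by exact_mod_cast hk
  have hkn' : (k : ℝ) ≤ n := by exact_mod_cast hkn
  have hn' : (1 : ℝ) ≤ n := hk'.trans hkn'
  have hm' : (1 : ℝ) ≤ m := by exact_mod_cast hm
  have hδk : 0 < δ * k := by positivity
  set L := Real.log (n / (δ * k)) with hL
  have hδn : δ * k ≤ δ * n := mul_le_mul_of_nonneg_left hkn' hδ.le
  have hL₁ : 1 / 2 ≤ L := by
    refine half_le_log_two.trans (Real.log_le_log two_pos ?_)
    rw [le_div_iff₀ hδk]
    nlinarith
  have hexp : Real.exp (-L) ≤ δ := by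
    rw [Real.exp_neg, hL, Real.exp_log (by positivity), inv_div, div_le_iff₀ (by positivity)]
    exact hδn
  have hlm : 0 ≤ Real.log m := Real.log_nonneg hm'
  have hln : 0 ≤ Real.log n := Real.log_nonneg hn'
  have hcm := clog_le_log hm
  have hcn := clog_le_log (hk.trans hkn)
  -- For `k = 1` the answer is always yes. This case is separate because `n = m = 1` makes the qubit
  -- bound `0`; for `k ≥ 2`, `log n ≥ 1/2` absorbs additive constants.
  rcases hk.eq_or_lt with rfl | hk2
  · obtain ⟨𝒜, hw, hq, hprob⟩ := (Reachable.init (n := n) (m := m) (z₀ := ())).exists_algorithm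
      (w := 0) (by simp) fun _ => true
    refine ⟨𝒜, fun A => ?_, ?_, ?_⟩
    · have hA : KDistinct A 1 := ⟨{⟨0, hkn⟩}, by simp, by simp⟩
      simp only [hA, decide_true, hprob, if_true]
      rw [Finset.sum_eq_single (0, 0, ())]
      · simp only [Pi.single_eq_same, norm_one, one_pow]
        linarith
      · intro q _ hq
        rw [Pi.single_eq_of_ne hq, norm_zero, zero_pow two_ne_zero]
      · simp
    · rw [hq, Nat.cast_zero]
      positivity
    · rw [QueryAlgorithm.qubits, hw]
      push_cast
      nlinarith [mul_nonneg (add_nonneg hlm hln) (sub_nonneg.2 hL₁)]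
  obtain ⟨a, ha₁, ha₂, ha₃⟩ := exists_iteration_bound hk2 hkn
  -- Since `3/4 ≤ exp (-1/4)`, `4L` repetitions push the error down to `exp (-L) = δk/n ≤ δ`.
  set r := ⌈4 * L⌉₊ with hr
  have hr₁ : 4 * L ≤ r := Nat.le_ceil _
  have hr₂ : (r : ℝ) ≤ 6 * L := by
    have := (Nat.ceil_lt_add_one (show 0 ≤ 4 * L by linarith)).le
    linarith
  have herr : ((3 : ℝ) / 4) ^ r ≤ δ := by
    have h₁ : (3 : ℝ) / 4 ≤ Real.exp (-1 / 4) := by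
      linarith [Real.add_one_le_exp (-1 / 4 : ℝ)]
    refine (pow_le_pow_left₀ (by norm_num) h₁ r).trans (le_trans ?_ hexp)
    rw [← Real.exp_nat_mul]
    exact Real.exp_le_exp.2 (by linarith)
  obtain ⟨𝒜, hw, hq, hprob⟩ := exists_search_algorithm hk m a r ha₁
  refine ⟨𝒜, fun A => by linarith [hprob A], ?_, ?_⟩
  · set M : ℝ := 2 ^ a with hM
    have hM₁ : 1 ≤ M := one_le_pow₀ one_le_two
    have hsk : 0 < Real.sqrt k := Real.sqrt_pos.2 (by linarith)
    have hMk : M * Real.sqrt k ≤ 3 * Real.sqrt n := by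
      have h : (k : ℝ) * M ^ 2 ≤ 8 * n := by
        rw [hM]
        exact_mod_cast ha₂
      refine abs_le_of_sq_le_sq' ?_ (by positivity) |>.2
      rw [mul_pow, mul_pow, Real.sq_sqrt (by linarith), Real.sq_sqrt (by linarith)]
      linarith
    have hpow : (n : ℝ) ^ (3 / 2 : ℝ) = n * Real.sqrt n := by
      rw [show (3 / 2 : ℝ) = 1 + 1 / 2 by norm_num, Real.rpow_add (by linarith), Real.rpow_one,
        ← Real.sqrt_eq_rpow]
    have hMle : M ≤ 3 * Real.sqrt n / Real.sqrt k := by rwa [le_div_iff₀ hsk]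
    calc (𝒜.queries : ℝ) = r * ((2 * M + 1) * (2 * n + 1)) := by
          rw [hq]
          push_cast
          ring
      _ ≤ 6 * L * ((3 * M) * (3 * n)) := by gcongr <;> linarith
      _ ≤ 6 * L * ((3 * (3 * Real.sqrt n / Real.sqrt k)) * (3 * n)) := by gcongr
      _ = 162 * ((n : ℝ) ^ (3 / 2 : ℝ) / Real.sqrt k * L) := by rw [hpow]; ring
      _ ≤ 200 * ((n : ℝ) ^ (3 / 2 : ℝ) / Real.sqrt k * L) := by gcongr; norm_num
  · have hl2 : 1 / 2 ≤ Real.log n := half_le_log_two.trans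
      (Real.log_le_log two_pos (by exact_mod_cast (show 2 ≤ n by omega)))
    have ha₃' : (a : ℝ) ≤ Nat.clog 2 n + 1 := by exact_mod_cast ha₃
    calc (𝒜.qubits : ℝ) = Nat.clog 2 n + Nat.clog 2 m +
          (2 * (Nat.clog 2 n + 1) + a + Nat.clog 2 m) * r := by
          rw [QueryAlgorithm.qubits, hw]
          push_cast
          ring
      -- One copy takes at most `3 * Nat.clog 2 n + 3 + Nat.clog 2 m` qubits; `clog ≤ 4 log` and `3
      -- ≤ 6 log n` give the `18`.
      _ ≤ 4 * Real.log n + 4 * Real.log m + (18 * (Real.log m + Real.log n)) * (6 * L) := by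
          gcongr
          linarith
      _ ≤ 200 * ((Real.log m + Real.log n) * L) := by
          nlinarith [mul_nonneg (add_nonneg hlm hln) (sub_nonneg.2 hL₁)]
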